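/- Notation. For $n\ge 0$ let $S\subseteq\mathbb F_2^n$. The set $S$ is a Sidon set if $a+b=c+d$ with $a,b,c,d\in S$, $a\ne b$, $c\ne d$ implies $\{a,b\}=\{c,d\}$. For an integer $k>0$, a Sidon set $S$ is a $k$-cover if every $p\in\mathbb F_2^n\setminus S$ can be written as $p=x+y+z$ for exactly $k$ three-element subsets $\{x,y,z\}\subseteq S$; when $k$ is not specified, "$S$ is a $k$-cover" means that $S$ is a $k$-cover for some $k>0$. The set $S$ has affine dimension $d$ if $d+1$ is the largest size of an affinely independent subset of $S$. It is separable if there is an affine hyperplane $H$ of $\mathbb F_2^n$ with $|H\cap S|=|S|/2$. The Boolean function $\gamma_S\colon\mathbb F_2^n\to\mathbb F_2$ is given by $\gamma_S(a)=1$ if $a\neq 0$ and $(a+S)\cap S\neq\emptyset$, and $\gamma_S(a)=0$ otherwise. The Cayley graph $\mathrm{Cay}(\gamma_S)$ has vertex set $\mathbb F_2^n$, and $u,v$ are adjacent if and only if $\gamma_S(u+v)=1$. Its eigenvalues are the distinct eigenvalues of its adjacency matrix. A graph is strongly regular with parameters $(v,d,\lambda,\mu)$ if it has $v$ vertices, is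 $d$-regular, any two adjacent vertices have exactly $\lambda$ common neighbours, and any two distinct non-adjacent vertices have exactly $\mu$ common neighbours. Theorem. Let $S\subseteq\mathbb F_2^n$ be a Sidon set of affine dimension $n$, and let $s=|S|>1$. (1) If $\mathrm{Cay}(\gamma_S)$ has exactly two eigenvalues, then $n\in\{1,2,4\}$, and if $n\neq 1$ then $S$ is a $k$-cover with $(n,s)\in\{(2,3),(4,6)\}$. (2) If $\mathrm{Cay}(\gamma_S)$ has at least three eigenvalues, then $S$ is a $k$-cover if and only if $\mathrm{Cay}(\gamma_S)$ is strongly regular (for some parameters) and $S$ is separable. (3) If $S$ is a $k$-cover and $\mathrm{Cay}(\gamma_S)$ is not complete, then $\mathrm{Cay}(\gamma_S)$ is strongly regular with parameters $$\left(2^n,\ \binom s2,\ \frac{3k}{2}\cdot\frac{2^{n+1}+s^2(s-3)}{s(s-1)},\ \frac{3k}{2}\,s\right),$$ or equivalently $$\left(2^n,\ \binom s2,\ \frac{(s-2)(s^3-3s^2+2^{n+1})}{4(2^n-s)},\ \frac{s^2(s-1)(s-2)}{4(2^n-s)}\right).$$ -/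

import Mathlib

/-- The vector space `𝔽₂ⁿ`. -/
abbrev F2 (n : ℕ) : Type := Fin n → ZMod 2

/-- Sidon sets in `𝔽₂ⁿ`: the sums of two distinct points of `S` are pairwise distinct. -/
def IsSidon {n : ℕ} (S : Finset (F2 n)) : Prop :=
  ∀ a ∈ S, ∀ b ∈ S, ∀ c ∈ S, ∀ d ∈ S, a ≠ b → c ≠ d → a + b = c + d →
    ({a, b} : Finset (F2 n)) = {c, d}

/-- The exclude multiplicity of `p`: the number of 3-element subsets `{x, y, z}` of `S`
with `x + y + z = p`. -/
def excludeMult {n : ℕ} (S : Finset (F2 n)) (p : F2 n) : ℕ :=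
  ((S.powersetCard 3).filter (fun T => ∑ x ∈ T, x = p)).card

/-- `S` is a `k`-cover for the given `k`. -/
def IsCoverWith {n : ℕ} (S : Finset (F2 n)) (k : ℕ) : Prop :=
  IsSidon S ∧ 0 < k ∧ ∀ p, p ∉ S → excludeMult S p = k

/-- `S` is a `k`-cover (for some `k > 0`). -/
def IsKCover {n : ℕ} (S : Finset (F2 n)) : Prop :=
  ∃ k, IsCoverWith S k

/-- `S` has affine dimension `d`: the largest size of an affinely independent subset of `S`
is `d + 1`. -/
def HasAffineDim {n : ℕ} (S : Finset (F2 n)) (d : ℕ) : Prop :=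
  IsGreatest {m : ℕ | ∃ T : Finset (F2 n), T ⊆ S ∧
    AffineIndependent (ZMod 2) (fun x : T => (x : F2 n)) ∧ T.card = m} (d + 1)

/-- An affine hyperplane of `𝔽₂ⁿ`: the solution set of one nontrivial affine equation. -/
def IsAffineHyperplane {n : ℕ} (H : Set (F2 n)) : Prop :=
  ∃ u : F2 n, u ≠ 0 ∧ ∃ c : ZMod 2, H = {x | u ⬝ᵥ x = c}

/-- `S` is separable: exactly half of its points lie in some affine hyperplane. -/
def IsSeparableSet {n : ℕ} (S : Finset (F2 n)) : Prop :=
  ∃ H : Set (F2 n), IsAffineHyperplane H ∧ 2 * (H ∩ (S : Set (F2 n))).ncard = S.card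

/-- The Boolean function `γ_S`, with `γ_S(a) = 1` iff `a ≠ 0` and `(a + S) ∩ S ≠ ∅`. -/
def gammaFun {n : ℕ} (S : Finset (F2 n)) (a : F2 n) : ZMod 2 :=
  if a ≠ 0 ∧ (S.image (fun x => a + x) ∩ S).Nonempty then 1 else 0

/-- The Cayley graph of a Boolean function: distinct `u`, `v` are adjacent iff `f (u + v) = 1`.
(The condition `u ≠ v` removes loops; it is automatic when `f 0 = 0`, as for `γ_S`.) -/
def cayleyGraph {n : ℕ} (f : F2 n → ZMod 2) : SimpleGraph (F2 n) where
  Adj u v := u ≠ v ∧ f (u + v) = 1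
  symm := ⟨fun u v h => ⟨h.1.symm, by rw [add_comm]; exact h.2⟩⟩
  loopless := ⟨fun _ h => h.1 rfl⟩

instance {n : ℕ} (f : F2 n → ZMod 2) : DecidableRel (cayleyGraph f).Adj :=
  fun u v => inferInstanceAs (Decidable (u ≠ v ∧ f (u + v) = 1))

/-- The set of (distinct) eigenvalues of a finite graph, i.e. of its real adjacency matrix. -/
def graphEigenvalues {V : Type*} [Fintype V] [DecidableEq V] (G : SimpleGraph V)
    [DecidableRel G.Adj] : Set ℝ :=
  {t : ℝ | Module.End.HasEigenvalue (Matrix.toLin' (G.adjMatrix ℝ)) t}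

/-- A graph is strongly regular if it is so for some parameters. -/
def IsStronglyRegular {V : Type*} [Fintype V] (G : SimpleGraph V) [DecidableRel G.Adj] : Prop :=
  ∃ v k l m : ℕ, G.IsSRGWith v k l m

/-! Everything is read off the integer Fourier transform `sig S` of the indicator of `S`; write s
for |S|. The characters diagonalise the Cayley graph, and the Sidon property says that 1_S * 1_S
equals s at 0 and twice the connection-set indicator elsewhere, so the eigenvalue at u is (sig(u)² -
s)/2 (`two_mul_gamHat`, `graphEigenvalues_eq`). The threefold convolution of 1_S is 3s - 2 on S and
6 times the exclude multiplicity off S. Hence being a cover amounts to sig³ = c·sig away from 0 for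
a constant c ≠ s² (`sig_cube_of_cover`, `isKCover_of_sig_cube`): sig² takes only the values 0 and c
there. Separability says that the value 0 occurs, and strong regularity that at most two eigenvalues
occur at u ≠ 0; this gives (2). For (3), the fourfold convolution, computed as 3 + 1 and as 2 + 2,
yields the common-neighbour counts (`gamConv_of_cover`). For (1), sig² is constant off 0. Inversion
gives sig² = s - 2 and s² - s + 2 = 2·2^n, and a divisibility argument leaves s = 2, 3, 6. -/

namespace F2

variable {n : ℕ}

/-! ### Characters of 𝔽₂ⁿ and Fourier inversion -/

lemma add_self (x : F2 n) : x + x = 0 := by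
  ext i; exact CharTwo.add_self_eq_zero (x i)

lemma add_eq_iff {x y z : F2 n} : x + y = z ↔ y = x + z := by
  constructor
  · rintro rfl; rw [← add_assoc, add_self, zero_add]
  · rintro rfl; rw [← add_assoc, add_self, zero_add]

lemma add_eq_zero {x y : F2 n} : x + y = 0 ↔ x = y := by
  rw [add_eq_iff, add_zero, eq_comm]

lemma sum_comp_add {M : Type*} [AddCommMonoid M] (f : F2 n → M) (a : F2 n) :
    ∑ x, f (a + x) = ∑ x, f x :=
  Fintype.sum_equiv (Equiv.addLeft a) _ _ fun _ => rfl

/-- The character `x ↦ (-1) ^ (u ⬝ x)`. -/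
def chi (u x : F2 n) : ℤ := if u ⬝ᵥ x = 0 then 1 else -1

lemma zmod_two_cases (a : ZMod 2) : a = 0 ∨ a = 1 := by
  revert a; decide

lemma chi_comm (u x : F2 n) : chi u x = chi x u := by
  rw [chi, chi, dotProduct_comm]

lemma chi_zero (u : F2 n) : chi u 0 = 1 := by simp [chi]

lemma zero_chi (x : F2 n) : chi 0 x = 1 := by simp [chi]

lemma chi_add (u x y : F2 n) : chi u (x + y) = chi u x * chi u y := by
  simp only [chi, dotProduct_add]
  rcases zmod_two_cases (u ⬝ᵥ x) with h | h <;> rcases zmod_two_cases (u ⬝ᵥ y) with h' | h' <;>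
    simp [h, h', CharTwo.add_self_eq_zero]

lemma chi_eq_or (u x : F2 n) : chi u x = 1 ∨ chi u x = -1 := by
  unfold chi; split_ifs <;> simp

lemma chi_eq_chi_iff {u x y : F2 n} : chi u x = chi u y ↔ u ⬝ᵥ x = u ⬝ᵥ y := by
  unfold chi
  rcases zmod_two_cases (u ⬝ᵥ x) with h | h <;> rcases zmod_two_cases (u ⬝ᵥ y) with h' | h' <;>
    simp [h, h']

lemma sum_chi_right {u : F2 n} (hu : u ≠ 0) : ∑ x, chi u x = 0 := by
  obtain ⟨i, hi⟩ := Function.ne_iff.1 hu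
  have h1 : u i = 1 := (zmod_two_cases (u i)).resolve_left hi
  -- Translating by a basis vector on which the character is -1 negates the sum.
  have h := sum_comp_add (chi u) (Pi.single i 1)
  have h2 : chi u (Pi.single i 1) = -1 := by simp [chi, h1]
  simp only [chi_add, h2, ← Finset.mul_sum] at h
  linarith

lemma sum_chi (x : F2 n) : ∑ u, chi u x = if x = 0 then 2 ^ n else 0 := by
  split_ifs with h
  · simp [h, chi_zero]
  · simp_rw [chi_comm _ x]; exact sum_chi_right h

/-- Fourier inversion for the number of solutions of `f i = p`. -/
lemma sum_chi_mul_sum {ι : Type*} (A : Finset ι) (f : ι → F2 n) (p : F2 n) :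
    ∑ u, chi u p * ∑ i ∈ A, chi u (f i) = 2 ^ n * ((A.filter fun i => f i = p).card : ℤ) := by
  simp_rw [Finset.mul_sum, ← chi_add]
  rw [Finset.sum_comm]
  simp_rw [sum_chi, add_eq_zero, eq_comm (a := p)]
  rw [← Finset.sum_filter, Finset.sum_const, nsmul_eq_mul, mul_comm]

/-- The Fourier transform of a counting function. -/
lemma sum_card_mul_chi {ι : Type*} (A : Finset ι) (f : ι → F2 n) (u : F2 n) :
    ∑ p, ((A.filter fun i => f i = p).card : ℤ) * chi u p = ∑ i ∈ A, chi u (f i) := by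
  rw [← Finset.sum_fiberwise A f]
  refine Finset.sum_congr rfl fun p _ => ?_
  rw [Finset.sum_congr rfl (g := fun _ => chi u p)]
  · simp
  · intro i hi; rw [(Finset.mem_filter.1 hi).2]

/-- The Fourier transform of the indicator function of `S`. -/
def sig (S : Finset (F2 n)) (u : F2 n) : ℤ := ∑ x ∈ S, chi u x

/-- The number of ordered representations `x + y = a` with `x, y ∈ S`. -/
def rep2 (S : Finset (F2 n)) (a : F2 n) : ℕ :=
  ((S ×ˢ S).filter fun q => q.1 + q.2 = a).card

/-- The number of ordered representations `x + y + z = a` with `x, y, z ∈ S`. -/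
def rep3 (S : Finset (F2 n)) (a : F2 n) : ℕ :=
  ((S ×ˢ S ×ˢ S).filter fun q => q.1 + (q.2.1 + q.2.2) = a).card

/-! ### Powers of the transform and representation counts -/

variable (S : Finset (F2 n))

lemma sig_zero : sig S 0 = S.card := by simp [sig, zero_chi]

lemma sig_sq (u : F2 n) : sig S u ^ 2 = ∑ q ∈ S ×ˢ S, chi u (q.1 + q.2) := by
  simp_rw [chi_add]
  rw [Finset.sum_product, sq, sig, Finset.sum_mul_sum]

lemma sig_cube (u : F2 n) :
    sig S u ^ 3 = ∑ q ∈ S ×ˢ S ×ˢ S, chi u (q.1 + (q.2.1 + q.2.2)) := by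
  rw [Finset.sum_product, pow_succ', sig_sq, sig, Finset.sum_mul_sum]
  simp_rw [chi_add]

lemma sum_chi_mul_sig (p : F2 n) :
    ∑ u, chi u p * sig S u = 2 ^ n * if p ∈ S then 1 else 0 := by
  have h := sum_chi_mul_sum S id p
  simp only [id] at h
  unfold sig
  rw [h, Finset.filter_eq']
  split_ifs <;> simp

lemma sum_chi_mul_sig_sq (p : F2 n) : ∑ u, chi u p * sig S u ^ 2 = 2 ^ n * (rep2 S p : ℤ) := by
  simp_rw [sig_sq]; exact sum_chi_mul_sum _ _ p

lemma sum_chi_mul_sig_cube (p : F2 n) :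
    ∑ u, chi u p * sig S u ^ 3 = 2 ^ n * (rep3 S p : ℤ) := by
  simp_rw [sig_cube]; exact sum_chi_mul_sum _ _ p

lemma sum_rep2_mul_chi (u : F2 n) : ∑ p, (rep2 S p : ℤ) * chi u p = sig S u ^ 2 := by
  rw [sig_sq]; exact sum_card_mul_chi _ _ u

lemma sum_rep3_mul_chi (u : F2 n) : ∑ p, (rep3 S p : ℤ) * chi u p = sig S u ^ 3 := by
  rw [sig_cube]; exact sum_card_mul_chi _ _ u

lemma rep2_zero : rep2 S 0 = S.card := by
  unfold rep2
  simp_rw [add_eq_zero]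
  rw [← Finset.diag_eq_filter]
  simp

lemma rep2_eq_sum (a : F2 n) : rep2 S a = ∑ x ∈ S, if a + x ∈ S then 1 else 0 := by
  unfold rep2
  rw [Finset.card_filter, Finset.sum_product]
  refine Finset.sum_congr rfl fun x _ => ?_
  simp_rw [add_eq_iff, add_comm x a]
  rw [Finset.sum_ite_eq']

lemma rep3_eq_sum (a : F2 n) : rep3 S a = ∑ x ∈ S, rep2 S (a + x) := by
  unfold rep3 rep2
  rw [Finset.card_filter, Finset.sum_product]
  refine Finset.sum_congr rfl fun x _ => ?_
  rw [Finset.card_filter]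
  simp_rw [add_eq_iff (x := x), add_comm x a]

/-- The fourfold additive count of `S`, computed in two ways. -/
lemma sum_rep3_eq (a : F2 n) : ∑ x ∈ S, rep3 S (a + x) = ∑ b, rep2 S b * rep2 S (a + b) := by
  have h : ∀ b, rep2 S b * rep2 S (a + b) =
      ∑ q ∈ S ×ˢ S, if q.1 + q.2 = b then rep2 S (a + b) else 0 := by
    intro b
    rw [← Finset.sum_filter, Finset.sum_const, rep2, smul_eq_mul]
  simp_rw [h]
  rw [Finset.sum_comm]
  simp only [Finset.sum_ite_eq, Finset.mem_univ, if_true]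
  rw [Finset.sum_product]
  simp_rw [rep3_eq_sum, add_assoc]

/-! ### Representation counts of Sidon sets -/

variable {S}

lemma gammaFun_eq_one {a : F2 n} : gammaFun S a = 1 ↔ a ≠ 0 ∧ ∃ x ∈ S, a + x ∈ S := by
  have h : (S.image (fun x => a + x) ∩ S).Nonempty ↔ ∃ x ∈ S, a + x ∈ S := by
    constructor
    · rintro ⟨y, hy⟩
      obtain ⟨hy, hyS⟩ := Finset.mem_inter.1 hy
      obtain ⟨x, hx, rfl⟩ := Finset.mem_image.1 hy
      exact ⟨x, hx, hyS⟩
    · rintro ⟨x, hx, hy⟩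
      exact ⟨a + x, Finset.mem_inter.2 ⟨Finset.mem_image_of_mem _ hx, hy⟩⟩
  rw [← h, gammaFun]
  split_ifs with h' <;> simp [h', -Finset.image_add_left]

variable (S) in
/-- The indicator function of the connection set of the Cayley graph. -/
def gam (a : F2 n) : ℕ := if gammaFun S a = 1 then 1 else 0

lemma gam_zero : gam S 0 = 0 := by simp [gam, gammaFun_eq_one]

lemma rep2_of_ne (hS : IsSidon S) {a : F2 n} (ha : a ≠ 0) : rep2 S a = 2 * gam S a := by
  unfold gam
  split_ifs with h
  · obtain ⟨-, x, hx, hy⟩ := gammaFun_eq_one.1 h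
    set y := a + x with hyd
    have hxy : x + y = a := by rw [hyd, add_eq_iff, add_comm]
    have hne : x ≠ y := fun e => ha (by rw [← hxy, e, add_self])
    have : ((S ×ˢ S).filter fun q => q.1 + q.2 = a) = {(x, y), (y, x)} := by
      ext ⟨p, q⟩
      simp only [Finset.mem_filter, Finset.mem_product, Finset.mem_insert, Finset.mem_singleton,
        Prod.mk.injEq]
      constructor
      · rintro ⟨⟨hp, hq⟩, hpq⟩
        have hpq' : p ≠ q := fun e => ha (by rw [← hpq, e, add_self])
        have e := hS p hp q hq x hx y hy hpq' hne (hpq.trans hxy.symm)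
        have h1 : p ∈ ({x, y} : Finset (F2 n)) := e ▸ by simp
        have h2 : q ∈ ({x, y} : Finset (F2 n)) := e ▸ by simp
        simp only [Finset.mem_insert, Finset.mem_singleton] at h1 h2
        grind
      · rintro (⟨rfl, rfl⟩ | ⟨rfl, rfl⟩)
        · exact ⟨⟨hx, hy⟩, hxy⟩
        · exact ⟨⟨hy, hx⟩, by rw [add_comm]; exact hxy⟩
    rw [rep2, this, Finset.card_pair]
    simp [hne]
  · rw [rep2, mul_zero, Finset.card_eq_zero, Finset.filter_eq_empty_iff]
    rintro ⟨p, q⟩ hpq rfl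
    rw [Finset.mem_product] at hpq
    refine h (gammaFun_eq_one.2 ⟨ha, p, hpq.1, ?_⟩)
    have : p + q + p = q := by rw [add_comm p q, add_assoc, add_self, add_zero]
    rw [this]; exact hpq.2

lemma rep2_eq (hS : IsSidon S) (a : F2 n) :
    rep2 S a = (if a = 0 then S.card else 0) + 2 * gam S a := by
  split_ifs with h
  · rw [h, rep2_zero, gam_zero]; rfl
  · rw [rep2_of_ne hS h, zero_add]

/-- Only trivial representations occur: x = p leaves y = z, in s ways, and each of the s - 1 other x
forces {y, z} = {p, x}, in two orders. -/
lemma rep3_of_mem (hS : IsSidon S) {p : F2 n} (hp : p ∈ S) : rep3 S p + 2 = 3 * S.card := by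
  rw [rep3_eq_sum, ← Finset.add_sum_erase _ _ hp, add_self, rep2_zero]
  rw [Finset.sum_congr rfl (g := fun _ => 2), Finset.sum_const, Finset.card_erase_of_mem hp]
  · have := Finset.card_pos.2 ⟨p, hp⟩
    simp; omega
  · intro x hx
    obtain ⟨hne, hx⟩ := Finset.mem_erase.1 hx
    have h0 : p + x ≠ 0 := fun h => hne (add_eq_zero.1 h).symm
    rw [rep2_of_ne hS h0, gam, if_pos]
    refine gammaFun_eq_one.2 ⟨h0, x, hx, ?_⟩
    rwa [add_assoc, add_self, add_zero]

lemma card_ordered_triples {α : Type*} [DecidableEq α] {S T : Finset α} (hTS : T ⊆ S)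
    (hT : T.card = 3) :
    ((S ×ˢ S ×ˢ S).filter fun q => ({q.1, q.2.1, q.2.2} : Finset α) = T).card = 6 := by
  obtain ⟨a, b, c, hab, hac, hbc, rfl⟩ := Finset.card_eq_three.1 hT
  have : ((S ×ˢ S ×ˢ S).filter fun q => ({q.1, q.2.1, q.2.2} : Finset α) = {a, b, c}) =
      {(a, b, c), (a, c, b), (b, a, c), (b, c, a), (c, a, b), (c, b, a)} := by
    ext ⟨x, y, z⟩
    have ha : a ∈ S := hTS (by simp)
    have hb : b ∈ S := hTS (by simp)
    have hc : c ∈ S := hTS (by simp)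
    simp only [Finset.mem_filter, Finset.mem_product, Finset.mem_insert, Finset.mem_singleton,
        Prod.mk.injEq]
    constructor
    · rintro ⟨-, h⟩
      have h1 : x ∈ ({a, b, c} : Finset α) := h ▸ by simp
      have h2 : y ∈ ({a, b, c} : Finset α) := h ▸ by simp
      have h3 : z ∈ ({a, b, c} : Finset α) := h ▸ by simp
      have h4 : a ∈ ({x, y, z} : Finset α) := h ▸ by simp
      have h5 : b ∈ ({x, y, z} : Finset α) := h ▸ by simp
      have h6 : c ∈ ({x, y, z} : Finset α) := h ▸ by simp
      simp only [Finset.mem_insert, Finset.mem_singleton] at h1 h2 h3 h4 h5 h6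
      grind
    · rintro (⟨rfl, rfl, rfl⟩ | ⟨rfl, rfl, rfl⟩ | ⟨rfl, rfl, rfl⟩ | ⟨rfl, rfl, rfl⟩ |
        ⟨rfl, rfl, rfl⟩ | ⟨rfl, rfl, rfl⟩) <;>
      exact ⟨⟨by assumption, by assumption, by assumption⟩, by
        ext; simp only [Finset.mem_insert, Finset.mem_singleton] <;> tauto⟩
  rw [this]
  simp [Finset.card_insert_of_notMem, hab, hac, hbc, hab.symm, hac.symm, hbc.symm]

/-- Two equal summands would cancel and put p in S, so the three are distinct and each 3-subset is
counted in its six orders. -/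
lemma rep3_of_notMem {p : F2 n} (hp : p ∉ S) : rep3 S p = 6 * excludeMult S p := by
  have key : ∀ q ∈ (S ×ˢ S ×ˢ S).filter (fun q => q.1 + (q.2.1 + q.2.2) = p),
      ({q.1, q.2.1, q.2.2} : Finset (F2 n)) ∈
        (S.powersetCard 3).filter (fun T => ∑ x ∈ T, x = p) := by
    rintro ⟨x, y, z⟩ h
    simp only [Finset.mem_filter, Finset.mem_product] at h
    obtain ⟨⟨hx, hy, hz⟩, rfl⟩ := h
    have hxy : x ≠ y := by
      rintro rfl; rw [← add_assoc, add_self, zero_add] at hp; exact hp hz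
    have hxz : x ≠ z := by
      rintro rfl; rw [add_left_comm, add_self, add_zero] at hp; exact hp hy
    have hyz : y ≠ z := by
      rintro rfl; rw [add_self, add_zero] at hp; exact hp hx
    simp only [Finset.mem_filter, Finset.mem_powersetCard]
    refine ⟨⟨?_, Finset.card_eq_three.2 ⟨x, y, z, hxy, hxz, hyz, rfl⟩⟩, ?_⟩
    · simp [Finset.insert_subset_iff, hx, hy, hz]
    · rw [Finset.sum_insert (by simp [hxy, hxz]), Finset.sum_pair hyz]
  rw [rep3, Finset.card_eq_sum_card_fiberwise key, excludeMult, mul_comm, ← smul_eq_mul,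
    ← Finset.sum_const]
  refine Finset.sum_congr rfl fun T hT => ?_
  simp only [Finset.mem_filter, Finset.mem_powersetCard] at hT
  obtain ⟨⟨hTS, hT3⟩, hTp⟩ := hT
  rw [← card_ordered_triples hTS hT3, Finset.filter_filter]
  congr 1
  refine Finset.filter_congr fun q _ => ⟨fun h => h.2, fun h => ⟨?_, h⟩⟩
  subst h
  rw [← hTp]
  have hxy : q.1 ≠ q.2.1 := by
    intro e; rw [e, Finset.insert_eq_of_mem (by simp)] at hT3
    have := Finset.card_le_two (a := q.2.1) (b := q.2.2); omega
  have hxz : q.1 ≠ q.2.2 := by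
    intro e; rw [e, Finset.insert_eq_of_mem (by simp)] at hT3
    have := Finset.card_le_two (a := q.2.1) (b := q.2.2); omega
  have hyz : q.2.1 ≠ q.2.2 := by
    intro e; rw [e, Finset.pair_eq_singleton] at hT3
    have := Finset.card_le_two (a := q.1) (b := q.2.2); omega
  rw [Finset.sum_insert (by simp [hxy, hxz]), Finset.sum_pair hyz]

/-! ### Spectrum of the Cayley graph -/

open scoped Matrix

variable (S) in
/-- The eigenvalue of the Cayley graph at the character `chi u`. -/
def gamHat (u : F2 n) : ℤ := ∑ a, (gam S a : ℤ) * chi u a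

lemma two_mul_gamHat (hS : IsSidon S) (u : F2 n) : 2 * gamHat S u = sig S u ^ 2 - S.card := by
  rw [← sum_rep2_mul_chi]
  simp_rw [rep2_eq hS]
  push_cast
  simp_rw [add_mul, Finset.sum_add_distrib, ite_mul, zero_mul]
  rw [Finset.sum_ite_eq', if_pos (Finset.mem_univ _), chi_zero, gamHat, Finset.mul_sum]
  simp_rw [mul_assoc]
  ring

lemma adj_iff {u v : F2 n} : (cayleyGraph (gammaFun S)).Adj u v ↔ gammaFun S (u + v) = 1 := by
  refine ⟨fun h => h.2, fun h => ⟨?_, h⟩⟩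
  rintro rfl
  rw [add_self] at h
  exact (gammaFun_eq_one.1 h).1 rfl

lemma adjMatrix_apply_eq (u v : F2 n) :
    (cayleyGraph (gammaFun S)).adjMatrix ℝ u v = gam S (u + v) := by
  rw [SimpleGraph.adjMatrix_apply, gam]
  simp only [adj_iff]
  split_ifs <;> simp

/-- The character `chi u` as a real vector. -/
def chiR (u : F2 n) : F2 n → ℝ := fun x => (chi u x : ℝ)

lemma adjMatrix_mulVec_chiR (u : F2 n) :
    (cayleyGraph (gammaFun S)).adjMatrix ℝ *ᵥ chiR u = (gamHat S u : ℝ) • chiR u := by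
  ext v
  simp only [Matrix.mulVec, dotProduct, adjMatrix_apply_eq, Pi.smul_apply, smul_eq_mul, chiR]
  rw [← sum_comp_add _ v]
  simp_rw [← add_assoc, add_self, zero_add, chi_add]
  rw [gamHat]
  push_cast
  rw [Finset.sum_mul]
  exact Finset.sum_congr rfl fun a _ => by ring

lemma chiR_ne_zero (u : F2 n) : chiR u ≠ 0 := by
  intro h
  have := congrFun h 0
  simp [chiR, chi_zero] at this

/-- Completeness of the characters; it ensures that they account for all eigenvalues. -/
lemma eq_zero_of_dotProduct_chiR {f : F2 n → ℝ} (h : ∀ u, chiR u ⬝ᵥ f = 0) : f = 0 := by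
  ext p
  have h1 : ∑ u, (chi u p : ℝ) * (chiR u ⬝ᵥ f) = 2 ^ n * f p := by
    simp only [dotProduct, chiR, Finset.mul_sum]
    rw [Finset.sum_comm]
    have h2 : ∀ x, ∑ u, (chi u p : ℝ) * ((chi u x : ℝ) * f x) =
        if x = p then 2 ^ n * f x else 0 := by
      intro x
      have h3 := sum_chi (p + x)
      simp_rw [chi_add, add_eq_zero] at h3
      simp_rw [← mul_assoc]
      rw [← Finset.sum_mul]
      have h4 : ∑ u, (chi u p : ℝ) * (chi u x : ℝ) = if p = x then 2 ^ n else 0 := by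
        exact_mod_cast h3
      rw [h4]
      simp_rw [eq_comm (a := p)]
      split_ifs <;> simp
    simp_rw [h2]
    simp
  simp only [h, mul_zero, Finset.sum_const_zero] at h1
  rcases mul_eq_zero.1 h1.symm with h2 | h2
  · exact absurd h2 (by positivity)
  · exact h2

lemma graphEigenvalues_eq :
    graphEigenvalues (cayleyGraph (gammaFun S)) = Set.range fun u => (gamHat S u : ℝ) := by
  ext t
  constructor
  · intro ht
    obtain ⟨f, hf⟩ := Module.End.HasEigenvalue.exists_hasEigenvector ht
    obtain ⟨hf, hf0⟩ := Module.End.hasEigenvector_iff.1 hf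
    rw [Module.End.mem_eigenspace_iff, Matrix.toLin'_apply] at hf
    by_contra hne
    refine hf0 (eq_zero_of_dotProduct_chiR fun u => ?_)
    -- By symmetry the matrix can be moved onto the character, so an eigenvector for any other value
    -- is orthogonal to every character.
    have h1 : chiR u ⬝ᵥ ((cayleyGraph (gammaFun S)).adjMatrix ℝ *ᵥ f) =
        (gamHat S u : ℝ) * (chiR u ⬝ᵥ f) := by
      rw [Matrix.dotProduct_mulVec, ← Matrix.mulVec_transpose,
        SimpleGraph.transpose_adjMatrix, adjMatrix_mulVec_chiR, smul_dotProduct, smul_eq_mul]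
    rw [hf, dotProduct_smul, smul_eq_mul] at h1
    have h2 : (t - gamHat S u) * (chiR u ⬝ᵥ f) = 0 := by linarith
    refine (mul_eq_zero.1 h2).resolve_left fun h => hne ⟨u, ?_⟩
    simp only; linarith
  · rintro ⟨u, rfl⟩
    refine Module.End.hasEigenvalue_of_hasEigenvector (x := chiR u)
      (Module.End.hasEigenvector_iff.2 ⟨?_, chiR_ne_zero u⟩)
    rw [Module.End.mem_eigenspace_iff, Matrix.toLin'_apply, adjMatrix_mulVec_chiR]

lemma ncard_graphEigenvalues_le_two (hS : IsSidon S) {a b : ℤ}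
    (h : ∀ u, sig S u ^ 2 = a ∨ sig S u ^ 2 = b) :
    (graphEigenvalues (cayleyGraph (gammaFun S))).ncard ≤ 2 := by
  rw [graphEigenvalues_eq]
  have hsub : (Set.range fun u => (gamHat S u : ℝ)) ⊆
      {((a - S.card : ℤ) : ℝ) / 2, ((b - S.card : ℤ) : ℝ) / 2} := by
    rintro _ ⟨u, rfl⟩
    have h2 : (2 : ℝ) * gamHat S u = ((sig S u ^ 2 - S.card : ℤ) : ℝ) := by
      exact_mod_cast two_mul_gamHat hS u
    simp only [Set.mem_insert_iff, Set.mem_singleton_iff]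
    rcases h u with h | h <;> rw [h] at h2
    · left; linarith
    · right; linarith
  exact (Set.ncard_le_ncard hsub (Set.toFinite _)).trans (by
    classical exact (Set.ncard_insert_le _ _).trans (by rw [Set.ncard_singleton]))

/-! ### Affine dimension and separability through the transform -/

lemma sig_sq_ne_of_affineDim (hdim : HasAffineDim S n) {u : F2 n} (hu : u ≠ 0) :
    sig S u ^ 2 ≠ (S.card : ℤ) ^ 2 := by
  intro hsq
  obtain ⟨T, hTS, hT, hcard⟩ := hdim.1
  have hconst : ∀ x ∈ S, ∀ y ∈ S, chi u x = chi u y := by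
    -- The sum is s² - sig(u)² with nonnegative terms, so each term vanishes and the character is
    -- constant on S.
    have h1 : ∑ q ∈ S ×ˢ S, (1 - chi u (q.1 + q.2)) = 0 := by
      rw [Finset.sum_sub_distrib, ← sig_sq, hsq]
      simp [sq]
    have h2 := (Finset.sum_eq_zero_iff_of_nonneg (fun q _ => by
      rcases chi_eq_or u (q.1 + q.2) with h | h <;> rw [h] <;> norm_num)).1 h1
    intro x hx y hy
    have h3 := h2 (x, y) (Finset.mk_mem_product hx hy)
    simp only [chi_add] at h3
    rcases chi_eq_or u x with h | h <;> rcases chi_eq_or u y with h' | h' <;>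
      rw [h, h'] at h3 ⊢ <;> norm_num at h3
  -- The n + 1 independent points span all directions, yet their differences lie in the kernel of x
  -- ↦ u ⬝ x.
  have htop := hT.vectorSpan_eq_top_of_card_eq_finrank_add_one (by simp [hcard])
  obtain ⟨i, hi⟩ := Function.ne_iff.1 hu
  let φ : F2 n →ₗ[ZMod 2] ZMod 2 := Fintype.linearCombination (ZMod 2) u
  have hφ : ∀ x, φ x = u ⬝ᵥ x := fun x => by
    simp [φ, Fintype.linearCombination_apply, dotProduct, mul_comm]
  have hle : vectorSpan (ZMod 2) (Set.range fun x : T => (x : F2 n)) ≤ LinearMap.ker φ := by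
    rw [vectorSpan, Submodule.span_le]
    rintro _ ⟨x, ⟨x, rfl⟩, y, ⟨y, rfl⟩, rfl⟩
    simp only [SetLike.mem_coe, LinearMap.mem_ker, vsub_eq_sub, hφ]
    rw [dotProduct_sub, sub_eq_zero]
    exact chi_eq_chi_iff.1 (hconst _ (hTS x.2) _ (hTS y.2))
  rw [htop, top_le_iff, LinearMap.ker_eq_top] at hle
  have := hφ (Pi.single i 1)
  rw [hle] at this
  simp at this
  exact hi this.symm

lemma isSeparableSet_iff : IsSeparableSet S ↔ ∃ u, u ≠ 0 ∧ sig S u = 0 := by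
  have key : ∀ u : F2 n,
      sig S u = 2 * ((S.filter fun x => u ⬝ᵥ x = 0).card : ℤ) - S.card ∧
      sig S u = S.card - 2 * ((S.filter fun x => u ⬝ᵥ x = 1).card : ℤ) := by
    intro u
    have h1 := Finset.card_filter_add_card_filter_not (s := S) (fun x => u ⬝ᵥ x = 0)
    have h2 : (S.filter fun x => u ⬝ᵥ x = 1) = S.filter fun x => ¬ u ⬝ᵥ x = 0 := by
      refine Finset.filter_congr fun x _ => ?_
      rcases zmod_two_cases (u ⬝ᵥ x) with h | h <;> simp [h]
    have h3 : sig S u = ((S.filter fun x => u ⬝ᵥ x = 0).card : ℤ) -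
        (S.filter fun x => ¬ u ⬝ᵥ x = 0).card := by
      rw [sig]
      unfold chi
      rw [Finset.sum_ite]
      simp; ring
    rw [h2, h3, ← h1]
    push_cast
    constructor <;> ring
  have hncard : ∀ (u : F2 n) (c : ZMod 2), ({x | u ⬝ᵥ x = c} ∩ (S : Set (F2 n))).ncard =
      (S.filter fun x => u ⬝ᵥ x = c).card := by
    intro u c
    rw [← Set.ncard_coe_finset]
    congr 1
    ext x
    simp [and_comm]
  constructor
  · rintro ⟨_, ⟨u, hu, c, rfl⟩, h⟩
    refine ⟨u, hu, ?_⟩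
    rw [hncard] at h
    rcases zmod_two_cases c with rfl | rfl
    · have := (key u).1; omega
    · have := (key u).2; omega
  · rintro ⟨u, hu, h⟩
    refine ⟨_, ⟨u, hu, 0, rfl⟩, ?_⟩
    rw [hncard]
    have := (key u).1
    omega

/-! ### Covers as a cubic equation for the transform -/

lemma sum_chi_mul_ite (p : F2 n) (f : F2 n → ℤ) (c : ℤ) (hf : ∀ u, u ≠ 0 → f u = c) :
    ∑ u, chi u p * f u = f 0 - c + c * if p = 0 then 2 ^ n else 0 := by
  rw [← sum_chi, Finset.mul_sum,
    ← Finset.add_sum_erase _ _ (Finset.mem_univ (0 : F2 n)),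
    ← Finset.add_sum_erase _ (fun u => c * chi u p) (Finset.mem_univ (0 : F2 n)), zero_chi]
  rw [Finset.sum_congr rfl (g := fun u => c * chi u p)]
  · ring
  · intro u hu
    rw [hf u (Finset.ne_of_mem_erase hu), mul_comm]

/-- The transform of 1_S * 1_S * 1_S - c·1_S is supported at 0, so this function is the constant
s(s² - c)/2^n, nonzero because c ≠ s². -/
lemma isKCover_of_sig_cube (hS : IsSidon S) (h0 : S.card ≠ 0) (c : ℤ)
    (h : ∀ u, u ≠ 0 → sig S u ^ 3 = c * sig S u) (hc : c ≠ (S.card : ℤ) ^ 2) : IsKCover S := by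
  have key : ∀ p, p ∉ S →
      2 ^ n * (6 * (excludeMult S p : ℤ)) = S.card * ((S.card : ℤ) ^ 2 - c) := by
    intro p hp
    have h1 := sum_chi_mul_sig_cube S p
    have h2 := sum_chi_mul_sig S p
    rw [if_neg hp] at h2
    rw [rep3_of_notMem hp] at h1
    have h3 : ∑ u, chi u p * (sig S u ^ 3 - c * sig S u) = sig S 0 ^ 3 - c * sig S 0 := by
      rw [sum_chi_mul_ite p _ 0 fun u hu => by rw [h u hu, sub_self]]
      ring
    simp_rw [mul_sub, Finset.sum_sub_distrib, mul_left_comm _ c] at h3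
    rw [← Finset.mul_sum, h1, h2, sig_zero] at h3
    push_cast at h3
    linear_combination h3
  by_cases hp : ∃ p, p ∉ S
  · obtain ⟨p, hp⟩ := hp
    refine ⟨excludeMult S p, hS, Nat.pos_of_ne_zero fun h => ?_, fun q hq => ?_⟩
    · have h1 := key p hp
      rw [h] at h1
      have h2 : (S.card : ℤ) * ((S.card : ℤ) ^ 2 - c) = 0 := by rw [← h1]; simp
      rcases mul_eq_zero.1 h2 with h3 | h3
      · exact h0 (by exact_mod_cast h3)
      · exact hc (by linarith)
    · have h1 := (key q hq).trans (key p hp).symm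
      have h2 : (2 : ℤ) ^ n ≠ 0 := by positivity
      have h3 := mul_left_cancel₀ h2 h1
      omega
  · push Not at hp
    -- If S is the whole space the covering condition is vacuous, and any positive k serves.
    exact ⟨1, hS, one_pos, fun p h => absurd (hp p) h⟩

lemma rep3_of_cover {k : ℕ} (h : IsCoverWith S k) (p : F2 n) :
    (rep3 S p : ℤ) = (3 * S.card - 2 - 6 * k) * (if p ∈ S then 1 else 0) + 6 * k := by
  split_ifs with hp
  · have := rep3_of_mem h.1 hp
    zify at this
    linarith
  · rw [rep3_of_notMem hp, h.2.2 p hp]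
    push_cast
    ring

lemma sum_rep3_of_cover {k : ℕ} (h : IsCoverWith S k) (u : F2 n) :
    sig S u ^ 3 = (3 * S.card - 2 - 6 * k) * sig S u + 6 * k * ∑ p, chi u p := by
  rw [← sum_rep3_mul_chi]
  simp_rw [rep3_of_cover h, add_mul, Finset.sum_add_distrib]
  congr 1
  · rw [sig, Finset.mul_sum]
    simp
  · rw [Finset.mul_sum]

lemma sig_cube_of_cover {k : ℕ} (h : IsCoverWith S k) {u : F2 n} (hu : u ≠ 0) :
    sig S u ^ 3 = (3 * S.card - 2 - 6 * k) * sig S u := by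
  rw [sum_rep3_of_cover h, sum_chi_right hu, mul_zero, add_zero]

/-- This is the transform identity at u = 0: both sides count ordered triples of distinct points of
S. -/
lemma card_of_cover {k : ℕ} (h : IsCoverWith S k) :
    (S.card : ℤ) * (S.card - 1) * (S.card - 2) = 6 * k * (2 ^ n - S.card) := by
  have := sum_rep3_of_cover h 0
  simp only [sig_zero, zero_chi] at this
  simp at this
  linear_combination this

/-! ### Common neighbours and strong regularity -/

variable (S) in
/-- The number of common neighbours of two vertices of the Cayley graph with sum `a`. -/
def gamConv (a : F2 n) : ℕ := ∑ b, gam S b * gam S (a + b)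

lemma card_commonNeighbors (v w : F2 n) :
    Fintype.card ((cayleyGraph (gammaFun S)).commonNeighbors v w) = gamConv S (v + w) := by
  rw [Fintype.card_of_subtype
    (Finset.univ.filter fun b => gammaFun S (v + b) = 1 ∧ gammaFun S (w + b) = 1),
    Finset.card_filter, ← sum_comp_add _ v, gamConv]
  · refine Finset.sum_congr rfl fun b _ => ?_
    rw [← add_assoc, add_self, zero_add, ← add_assoc, add_comm w v, gam, gam]
    split_ifs <;> simp_all
  · intro x
    simp [SimpleGraph.mem_commonNeighbors, adj_iff]

lemma isRegular (hS : IsSidon S) :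
    (cayleyGraph (gammaFun S)).IsRegularOfDegree (S.card.choose 2) := by
  intro v
  have h1 : (cayleyGraph (gammaFun S)).degree v = ∑ a, gam S a := by
    rw [← SimpleGraph.card_neighborFinset_eq_degree, SimpleGraph.neighborFinset_eq_filter,
      Finset.card_filter, ← sum_comp_add _ v]
    refine Finset.sum_congr rfl fun a _ => ?_
    rw [gam]
    simp only [adj_iff, ← add_assoc, add_self, zero_add]
  have h2 := two_mul_gamHat hS 0
  simp only [gamHat, zero_chi, sig_zero, mul_one] at h2
  rw [h1, Nat.choose_two_right]
  refine (Nat.div_eq_of_eq_mul_right two_pos ?_).symm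
  rw [Nat.mul_sub, mul_one]
  zify [Nat.le_mul_self S.card]
  linear_combination -h2

/-- The cover property makes the threefold count affine in 1_S; one more convolution with 1_S makes
the fourfold count affine in `gam`. -/
lemma gamConv_of_cover {k : ℕ} (h : IsCoverWith S k) {a : F2 n} (ha : a ≠ 0) :
    4 * (gamConv S a : ℤ) =
      (2 * S.card - 4 - 12 * k) * gam S a + 6 * k * S.card := by
  have h1 : (∑ x ∈ S, (rep3 S (a + x) : ℤ)) = ∑ b, (rep2 S b : ℤ) * rep2 S (a + b) := by
    exact_mod_cast sum_rep3_eq S a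
  have h2 : (∑ x ∈ S, (rep3 S (a + x) : ℤ)) =
      (3 * S.card - 2 - 6 * k) * rep2 S a + 6 * k * S.card := by
    simp_rw [rep3_of_cover h, Finset.sum_add_distrib]
    rw [← Finset.mul_sum, rep2_eq_sum]
    push_cast
    rw [Finset.sum_const, nsmul_eq_mul]
    ring
  -- The terms b = 0 and b = a each contribute s · 2 `gam S a`, from the diagonal value `rep2 S 0`.
  have h3 : ∑ b, (rep2 S b : ℤ) * rep2 S (a + b) = 4 * S.card * gam S a + 4 * gamConv S a := by
    simp_rw [rep2_eq h.1, add_eq_zero]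
    push_cast
    simp_rw [add_mul, mul_add, Finset.sum_add_distrib]
    simp only [ite_mul, mul_ite, zero_mul, mul_zero, Finset.sum_ite_eq, Finset.sum_ite_eq',
      Finset.mem_univ, if_true, add_zero, if_neg ha]
    rw [gamConv]
    push_cast
    rw [Finset.mul_sum, zero_add, ← add_assoc]
    congr 1
    · ring
    · exact Finset.sum_congr rfl fun b _ => by ring
  have h4 : (rep2 S a : ℤ) = 2 * gam S a := by exact_mod_cast rep2_of_ne h.1 ha
  rw [h2, h3, h4] at h1
  linear_combination -h1

lemma gam_eq (a : F2 n) : gam S a = 0 ∨ gam S a = 1 := by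
  unfold gam; split_ifs <;> simp

lemma adj_iff_gam {u v : F2 n} : (cayleyGraph (gammaFun S)).Adj u v ↔ gam S (u + v) = 1 := by
  rw [adj_iff, gam]; split_ifs with h <;> simp [h]

lemma gam_add_eq_one {x y : F2 n} (hx : x ∈ S) (hy : y ∈ S) (h : x ≠ y) :
    gam S (x + y) = 1 := by
  rw [gam, if_pos]
  refine gammaFun_eq_one.2 ⟨fun e => h (add_eq_zero.1 e), y, hy, ?_⟩
  rwa [add_assoc, add_self, add_zero]

lemma eq_top_iff_gam : cayleyGraph (gammaFun S) = ⊤ ↔ ∀ a, a ≠ 0 → gam S a = 1 := by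
  constructor
  · intro h a ha
    have : (cayleyGraph (gammaFun S)).Adj 0 a := by rw [h]; exact ha.symm
    rw [adj_iff_gam, zero_add] at this
    exact this
  · intro h
    ext u v
    rw [adj_iff_gam, SimpleGraph.top_adj]
    refine ⟨?_, fun hne => h _ fun e => hne (add_eq_zero.1 e)⟩
    rintro h1 rfl
    rw [add_self, gam_zero] at h1
    exact zero_ne_one h1

lemma sig_sq_of_eq_top (hS : IsSidon S) (h : cayleyGraph (gammaFun S) = ⊤) {u : F2 n}
    (hu : u ≠ 0) : sig S u ^ 2 = (S.card : ℤ) - 2 := by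
  have h1 := two_mul_gamHat hS u
  have h2 : gamHat S u + 1 = ∑ a, chi u a := by
    rw [gamHat, ← Finset.add_sum_erase _ _ (Finset.mem_univ (0 : F2 n)),
      ← Finset.add_sum_erase _ (chi u) (Finset.mem_univ (0 : F2 n)), gam_zero, chi_zero]
    rw [Finset.sum_congr rfl (g := chi u)]
    · push_cast; ring
    · intro a ha
      rw [eq_top_iff_gam.1 h a (Finset.ne_of_mem_erase ha)]
      simp
  rw [sum_chi_right hu] at h2
  linarith

/-- A `k`-cover with a non-complete Cayley graph has a strongly regular Cayley graph. -/
theorem isSRGWith_of_cover (hs1 : 1 < S.card) {k : ℕ} (h : IsCoverWith S k)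
    (hne : cayleyGraph (gammaFun S) ≠ ⊤) :
    ∃ l m : ℕ, (cayleyGraph (gammaFun S)).IsSRGWith (2 ^ n) (S.card.choose 2) l m ∧
      4 * (l : ℤ) = 2 * S.card - 4 - 12 * k + 6 * k * S.card ∧ 4 * (m : ℤ) = 6 * k * S.card ∧
      (2 : ℤ) ^ n ≠ S.card := by
  obtain ⟨x, hx, y, hy, hxy⟩ := Finset.one_lt_card.1 hs1
  have hxy0 : x + y ≠ 0 := fun e => hxy (add_eq_zero.1 e)
  obtain ⟨b, hb, hb1⟩ : ∃ b, b ≠ 0 ∧ gam S b ≠ 1 := by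
    by_contra! hc; exact hne (eq_top_iff_gam.2 hc)
  have hb0 : gam S b = 0 := (gam_eq b).resolve_right hb1
  have hl := gamConv_of_cover h hxy0
  have hm := gamConv_of_cover h hb
  rw [gam_add_eq_one hx hy hxy] at hl
  rw [hb0] at hm
  push_cast at hl hm
  refine ⟨gamConv S (x + y), gamConv S b, ⟨by simp, isRegular h.1, ?_, ?_⟩, by linarith,
    by linarith, ?_⟩
  · intro v w hvw
    have h1 := gamConv_of_cover h fun e => hvw.ne (add_eq_zero.1 e)
    rw [adj_iff_gam.1 hvw] at h1
    rw [card_commonNeighbors]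
    push_cast at h1
    have : (gamConv S (v + w) : ℤ) = gamConv S (x + y) := by linarith
    exact_mod_cast this
  · intro v w hvw hadj
    have h1 := gamConv_of_cover h fun e => hvw (add_eq_zero.1 e)
    rw [adj_iff_gam] at hadj
    rw [(gam_eq (v + w)).resolve_right hadj] at h1
    rw [card_commonNeighbors]
    push_cast at h1
    have : (gamConv S (v + w) : ℤ) = gamConv S b := by linarith
    exact_mod_cast this
  · intro e
    have hu : S = Finset.univ := by
      rw [← Finset.card_eq_iff_eq_univ]
      simp only [Fintype.card_pi, ZMod.card, Finset.prod_const, Finset.card_univ, Fintype.card_fin]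
      exact_mod_cast e.symm
    -- If S were everything, b = b + 0 would be a sum of two distinct points of S.
    have := gam_add_eq_one (S := S) (x := b) (y := 0) (by simp [hu]) (by simp [hu]) hb
    rw [add_zero] at this
    exact hb1 this

/-! ### At least three eigenvalues -/

theorem isSeparableSet_of_cover (hS : IsSidon S) (h : IsKCover S)
    (h3 : 3 ≤ (graphEigenvalues (cayleyGraph (gammaFun S))).ncard) : IsSeparableSet S := by
  obtain ⟨k, h⟩ := h
  rw [isSeparableSet_iff]
  by_contra! hc
  -- Without a zero of the transform, the cubic relation can be divided by sig(u), leaving one value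
  -- of sig² off 0.
  have := ncard_graphEigenvalues_le_two hS (a := (S.card : ℤ) ^ 2)
    (b := 3 * S.card - 2 - 6 * k) fun u => by
      by_cases hu : u = 0
      · left; rw [hu, sig_zero]
      · right
        have := sig_cube_of_cover h hu
        exact mul_right_cancel₀ (hc u hu) (by linear_combination this)
  omega

theorem ne_top_of_three_le (hS : IsSidon S)
    (h3 : 3 ≤ (graphEigenvalues (cayleyGraph (gammaFun S))).ncard) :
    cayleyGraph (gammaFun S) ≠ ⊤ := by
  intro h
  have := ncard_graphEigenvalues_le_two hS (a := (S.card : ℤ) ^ 2) (b := S.card - 2) fun u => by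
    by_cases hu : u = 0
    · left; rw [hu, sig_zero]
    · right; exact sig_sq_of_eq_top hS h hu
  omega

/-- Apply A² = dI + lA + m(J - I - A) to a nontrivial character, which J annihilates, and evaluate
at 0. -/
lemma gamHat_sq_of_isSRGWith {v d l m : ℕ}
    (h : (cayleyGraph (gammaFun S)).IsSRGWith v d l m) {u : F2 n} (hu : u ≠ 0) :
    gamHat S u ^ 2 = d + l * gamHat S u + m * (-1 - gamHat S u) := by
  have hA := h.matrix_eq (α := ℝ)
  have hcompl : (cayleyGraph (gammaFun S))ᶜ.adjMatrix ℝ =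
      Matrix.of 1 - 1 - (cayleyGraph (gammaFun S)).adjMatrix ℝ := by
    ext x y
    by_cases hxy : x = y
    · simp [hxy]
    · by_cases ha : (cayleyGraph (gammaFun S)).Adj x y <;> simp [hxy, ha]
  rw [hcompl] at hA
  have hJ : (Matrix.of 1 : Matrix (F2 n) (F2 n) ℝ) *ᵥ chiR u = 0 := by
    ext x
    have : ∑ x, (chi u x : ℝ) = 0 := by exact_mod_cast sum_chi_right hu
    simpa [Matrix.mulVec, dotProduct, chiR] using this
  have h1 := congrFun (congrArg (fun M => M *ᵥ chiR u) hA) 0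
  simp only [sq, ← Matrix.mulVec_mulVec, Matrix.add_mulVec, Matrix.smul_mulVec,
    Matrix.sub_mulVec, adjMatrix_mulVec_chiR, Matrix.mulVec_smul, hJ, Matrix.one_mulVec] at h1
  simp [chiR, chi_zero] at h1
  rw [sq]
  have h2 : ((gamHat S u * gamHat S u : ℤ) : ℝ) =
      ((d + l * gamHat S u + m * (-1 - gamHat S u) : ℤ) : ℝ) := by
    push_cast
    linarith
  exact_mod_cast h2

theorem isKCover_of_isSRGWith (hS : IsSidon S) (hs1 : 1 < S.card)
    (h3 : 3 ≤ (graphEigenvalues (cayleyGraph (gammaFun S))).ncard)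
    {v d l m : ℕ} (h : (cayleyGraph (gammaFun S)).IsSRGWith v d l m)
    (hsep : IsSeparableSet S) : IsKCover S := by
  obtain ⟨w, hw, hw0⟩ := isSeparableSet_iff.1 hsep
  -- Separability makes -s/2 one root of the quadratic for the eigenvalues; by Vieta the other is l
  -- - m + s/2, where sig² = 2(l - m) + 2s.
  have key : ∀ u, u ≠ 0 → sig S u ^ 2 = 0 ∨ sig S u ^ 2 = 2 * ((l : ℤ) - m) + 2 * S.card := by
    intro u hu
    have h1 := gamHat_sq_of_isSRGWith h hu
    have h2 := gamHat_sq_of_isSRGWith h hw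
    have h4 := two_mul_gamHat hS u
    have h5 := two_mul_gamHat hS w
    rw [hw0] at h5
    have h6 : sig S u ^ 2 * (sig S u ^ 2 - (2 * ((l : ℤ) - m) + 2 * S.card)) = 0 := by
      have e1 : sig S u ^ 2 = 2 * gamHat S u - 2 * gamHat S w := by linarith
      have e2 : (S.card : ℤ) = -2 * gamHat S w := by linarith
      rw [e1, e2]
      linear_combination 4 * h1 - 4 * h2
    rcases mul_eq_zero.1 h6 with h7 | h7
    · exact Or.inl h7
    · right; linarith
  refine isKCover_of_sig_cube hS (by omega) (2 * ((l : ℤ) - m) + 2 * S.card) (fun u hu => ?_) ?_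
  · rcases key u hu with h1 | h1
    · rw [pow_eq_zero_iff two_ne_zero] at h1
      rw [h1]; ring
    · rw [pow_succ, h1]
  · intro hc
    -- If c = s², the value at u = 0 is not new and sig² takes only two values.
    have := ncard_graphEigenvalues_le_two hS (a := 0) (b := (S.card : ℤ) ^ 2) fun u => by
      by_cases hu : u = 0
      · right; rw [hu, sig_zero]
      · rw [← hc]; exact key u hu
    omega

/-! ### Exactly two eigenvalues -/

/-- The case of exactly two eigenvalues: away from `0` the squared transform is constant. -/
lemma exists_sig_sq_eq (hS : IsSidon S) (hdim : HasAffineDim S n)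
    (h2 : (graphEigenvalues (cayleyGraph (gammaFun S))).ncard = 2) :
    (∃ u : F2 n, u ≠ 0) ∧ ∃ c, c ≠ (S.card : ℤ) ^ 2 ∧ ∀ u, u ≠ 0 → sig S u ^ 2 = c := by
  rw [graphEigenvalues_eq] at h2
  have hex : ∃ u : F2 n, u ≠ 0 := by
    by_contra! hc
    have : (Set.range fun u => (gamHat S u : ℝ)) ⊆ {(gamHat S 0 : ℝ)} := by
      rintro _ ⟨u, rfl⟩; rw [hc u]; rfl
    have := Set.ncard_le_ncard this (Set.toFinite _)
    rw [h2, Set.ncard_singleton] at this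
    omega
  refine ⟨hex, ?_⟩
  have hne : ∀ u, u ≠ 0 → gamHat S u ≠ gamHat S 0 := by
    intro u hu he
    have h1 := two_mul_gamHat hS u
    have h0 := two_mul_gamHat hS 0
    rw [sig_zero] at h0
    exact sig_sq_ne_of_affineDim hdim hu (by linarith)
  obtain ⟨w, hw⟩ := hex
  refine ⟨_, sig_sq_ne_of_affineDim hdim hw, fun u hu => ?_⟩
  obtain ⟨a, b, -, hab⟩ := Set.ncard_eq_two.1 h2
  have hmem : ∀ u, (gamHat S u : ℝ) = a ∨ (gamHat S u : ℝ) = b := by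
    intro u
    have : (gamHat S u : ℝ) ∈ ({a, b} : Set ℝ) := hab ▸ ⟨u, rfl⟩
    simpa using this
  have hnu : (gamHat S u : ℝ) ≠ gamHat S 0 := by exact_mod_cast hne u hu
  have hnw : (gamHat S w : ℝ) ≠ gamHat S 0 := by exact_mod_cast hne w hw
  have huw : (gamHat S u : ℝ) = gamHat S w := by
    have := hmem u
    have := hmem w
    have := hmem 0
    grind
  have huw' : gamHat S u = gamHat S w := by exact_mod_cast huw
  have h4 := two_mul_gamHat hS u
  have h5 := two_mul_gamHat hS w
  rw [huw'] at h4
  linarith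

/-- A Sidon set whose Cayley graph has two eigenvalues has a flat Fourier spectrum. -/
lemma flat_spectrum (hS : IsSidon S) {w : F2 n} (hw : w ≠ 0) {c : ℤ}
    (hc : c ≠ (S.card : ℤ) ^ 2) (h : ∀ u, u ≠ 0 → sig S u ^ 2 = c) :
    c = S.card - 2 ∧ (S.card : ℤ) ^ 2 - c = 2 * 2 ^ n := by
  have h0 := sum_chi_mul_sig_sq S 0
  have h1 := sum_chi_mul_sig_sq S w
  rw [sum_chi_mul_ite _ _ c h, sig_zero] at h0 h1
  rw [rep2_zero, if_pos rfl] at h0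
  rw [rep2_of_ne hS hw, if_neg hw] at h1
  have hp : (2 : ℤ) ^ n ≠ 0 := by positivity
  -- Inversion at w reads s² - c = 2^n · 2 `gam S w`, so c ≠ s² forces w into the connection set.
  rcases gam_eq (S := S) w with hg | hg
  · rw [hg] at h1
    push_cast at h1
    exact absurd (by linarith) hc
  · rw [hg] at h1
    push_cast at h1
    refine ⟨mul_left_cancel₀ hp ?_, by linarith⟩
    linarith

theorem two_eigenvalues (hS : IsSidon S) (hs1 : 1 < S.card) (hdim : HasAffineDim S n)
    (h2 : (graphEigenvalues (cayleyGraph (gammaFun S))).ncard = 2) :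
    (n = 1 ∨ n = 2 ∨ n = 4) ∧
      (n ≠ 1 → IsKCover S ∧ ((n = 2 ∧ S.card = 3) ∨ (n = 4 ∧ S.card = 6))) := by
  obtain ⟨⟨w, hw⟩, c, hc, h⟩ := exists_sig_sq_eq hS hdim h2
  have hcov : IsKCover S := isKCover_of_sig_cube hS (by omega) c
    (fun u hu => by rw [pow_succ, h u hu]) hc
  obtain ⟨hcs, hpow⟩ := flat_spectrum hS hw hc h
  rw [hcs] at hpow
  have hwc := h w hw
  rw [hcs] at hwc
  have hcases : S.card = 2 ∨ S.card = 3 ∨ S.card = 6 := by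
    by_cases hp : ∃ p, p ∉ S
    · obtain ⟨p, hp⟩ := hp
      have h3 := sum_chi_mul_sig S p
      rw [if_neg hp, mul_zero, ← Finset.add_sum_erase _ _ (Finset.mem_univ (0 : F2 n)), zero_chi,
        sig_zero, one_mul] at h3
      -- All nontrivial values are ± sig(w), so inversion at p ∉ S gives sig(w) ∣ s; with sig(w)² =
      -- s - 2 this yields sig(w) ∣ 2.
      have hdvd : sig S w ∣ ∑ u ∈ Finset.univ.erase 0, chi u p * sig S u := by
        refine Finset.dvd_sum fun u hu => ?_
        have h4 : sig S u ^ 2 = sig S w ^ 2 := by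
          rw [h u (Finset.ne_of_mem_erase hu), h w hw]
        rcases sq_eq_sq_iff_eq_or_eq_neg.1 h4 with h5 | h5 <;> rw [h5] <;> simp
      have h4 : sig S w ∣ (S.card : ℤ) := by
        rw [eq_neg_of_add_eq_zero_left h3]; exact (dvd_neg).2 hdvd
      have h5 : sig S w ∣ 2 := by
        have : (2 : ℤ) = S.card - sig S w * sig S w := by linarith
        rw [this]
        exact dvd_sub h4 (dvd_mul_right _ _)
      have h6 := Int.le_of_dvd two_pos h5
      have h7 := Int.le_of_dvd two_pos ((neg_dvd).2 h5)
      have h8 : -2 ≤ sig S w := by linarith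
      generalize sig S w = m at *
      interval_cases m <;> omega
    · push Not at hp
      have hu : S = Finset.univ := Finset.eq_univ_iff_forall.2 hp
      have hcard : (S.card : ℤ) = 2 ^ n := by simp [hu]
      rw [← hcard] at hpow
      have : ((S.card : ℤ) - 1) * (S.card - 2) = 0 := by linarith
      rcases mul_eq_zero.1 this with h5 | h5 <;> omega
  have hn : ∀ m, (2 : ℤ) ^ n = 2 ^ m → n = m := fun m hm =>
    Nat.pow_right_injective le_rfl (by exact_mod_cast hm)
  rcases hcases with h5 | h5 | h5 <;> rw [h5] at hpow <;> norm_num at hpow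
  · have := hn 1 (by linarith)
    exact ⟨Or.inl this, fun h => absurd this h⟩
  · have := hn 2 (by linarith)
    exact ⟨Or.inr (Or.inl this), fun _ => ⟨hcov, Or.inl ⟨this, h5⟩⟩⟩
  · have := hn 4 (by linarith)
    exact ⟨Or.inr (Or.inr this), fun _ => ⟨hcov, Or.inr ⟨this, h5⟩⟩⟩

end F2

theorem mainTheorem1 (n s : ℕ) (S : Finset (F2 n)) (hS : IsSidon S) (hs : S.card = s)
    (hdim : HasAffineDim S n) (hs1 : 1 < s) :
    ((graphEigenvalues (cayleyGraph (gammaFun S))).ncard = 2 →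
      (n = 1 ∨ n = 2 ∨ n = 4) ∧
      (n ≠ 1 → IsKCover S ∧ ((n = 2 ∧ s = 3) ∨ (n = 4 ∧ s = 6)))) ∧
    (3 ≤ (graphEigenvalues (cayleyGraph (gammaFun S))).ncard →
      (IsKCover S ↔ IsStronglyRegular (cayleyGraph (gammaFun S)) ∧ IsSeparableSet S)) ∧
    (∀ k : ℕ, IsCoverWith S k → cayleyGraph (gammaFun S) ≠ ⊤ →
      ∃ l m : ℕ, (cayleyGraph (gammaFun S)).IsSRGWith (2 ^ n) (s.choose 2) l m ∧
        (l : ℚ) = 3 * (k : ℚ) / 2 * ((2 ^ (n + 1) + (s : ℚ) ^ 2 * ((s : ℚ) - 3)) /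
          ((s : ℚ) * ((s : ℚ) - 1))) ∧
        (m : ℚ) = 3 * (k : ℚ) / 2 * (s : ℚ) ∧
        (l : ℚ) = ((s : ℚ) - 2) * ((s : ℚ) ^ 3 - 3 * (s : ℚ) ^ 2 + 2 ^ (n + 1)) /
          (4 * (2 ^ n - (s : ℚ))) ∧
        (m : ℚ) = (s : ℚ) ^ 2 * ((s : ℚ) - 1) * ((s : ℚ) - 2) / (4 * (2 ^ n - (s : ℚ)))) := by
  subst hs
  refine ⟨F2.two_eigenvalues hS hs1 hdim, fun h3 => ⟨fun h => ?_, ?_⟩, fun k hk hne => ?_⟩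
  · refine ⟨?_, F2.isSeparableSet_of_cover hS h h3⟩
    obtain ⟨k, hk⟩ := h
    obtain ⟨l, m, h, -⟩ := F2.isSRGWith_of_cover hs1 hk (F2.ne_top_of_three_le hS h3)
    exact ⟨_, _, l, m, h⟩
  · rintro ⟨⟨v, d, l, m, h⟩, hsep⟩
    exact F2.isKCover_of_isSRGWith hS hs1 h3 h hsep
  · obtain ⟨l, m, h, hl, hm, hN⟩ := F2.isSRGWith_of_cover hs1 hk hne
    have hcount := F2.card_of_cover hk
    refine ⟨l, m, h, ?_⟩
    have hl' : 4 * (l : ℚ) = 2 * S.card - 4 - 12 * k + 6 * k * S.card := by exact_mod_cast hl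
    have hm' : 4 * (m : ℚ) = 6 * k * S.card := by exact_mod_cast hm
    have hN' : (2 : ℚ) ^ n - S.card ≠ 0 := sub_ne_zero.2 (by exact_mod_cast hN)
    have hc' : (S.card : ℚ) * (S.card - 1) * (S.card - 2) = 6 * k * (2 ^ n - S.card) := by
      exact_mod_cast hcount
    have hs1' : (1 : ℚ) < S.card := by exact_mod_cast hs1
    have hs0 : (S.card : ℚ) ≠ 0 := by linarith
    have hs2 : (S.card : ℚ) - 1 ≠ 0 := by linarith
    rw [pow_succ]
    generalize (S.card : ℚ) = s at *
    generalize (2 : ℚ) ^ n = N at *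
    refine ⟨?_, by linarith, ?_, ?_⟩
    -- Each formula follows from the values of 4l and 4m together with the triple count `hc'`, which
    -- trades k for s and 2^n.
    · rw [mul_div_assoc', eq_div_iff (mul_ne_zero hs0 hs2)]
      linear_combination s * (s - 1) / 4 * hl' + hc' / 2
    · rw [eq_div_iff (mul_ne_zero four_ne_zero hN')]
      linear_combination (N - s) * hl' - (s - 2) * hc'
    · rw [eq_div_iff (mul_ne_zero four_ne_zero hN')]
      linear_combination (N - s) * hm' - s * hc'
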